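/- Let $\mathcal C_-$ (clients), $\mathcal C_+$ (relays) and $\mathcal A$ (access points) be finite sets, and let $\mathcal C_-'=\mathcal C_-\cup\{u\}$ and $\mathcal C_+'=\mathcal C_+\cup\{v\}$, where $u$ is a virtual client and $v$ a virtual relay. Let $b_{ijk}\in\mathbb R$ for $i\in\mathcal C_-'$, $j\in\mathcal C_+'$, $k\in\mathcal A$, and let $w_{ij}=2$ if $i\in\mathcal C_-$ and $j\in\mathcal C_+$, and $w_{ij}=1$ otherwise. Put $0\log 0:=0$. Consider the binary problem $$\max_{\mathbf z,\mathbf n}\ \sum_{k\in\mathcal A}\sum_{i\in\mathcal C_-'}\sum_{j\in\mathcal C_+'} b_{ijk}z_{ijk}-\sum_{k\in\mathcal A}n_k\log n_k \qquad (P)$$ subject to $$z_{ijk}\in\{0,1\}\ (i\in\mathcal C_-',\,j\in\mathcal C_+',\,k\in\mathcal A),\qquad n_k=\sum_{i\in\mathcal C_-'}\sum_{j\in\mathcal C_+'}w_{ij}z_{ijk}\ (k\in\mathcal A),$$ $$\sum_{k\in\mathcal A}\sum_{j\in\mathcal C_+'}z_{ijk}=1\ (i\in\mathcal C_-),\qquad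 \sum_{k\in\mathcal A}\sum_{i\in\mathcal C_-'}z_{ijk}=1\ (j\in\mathcal C_+),$$ and let $(R)$ be its continuous relaxation, in which $z_{ijk}\in\{0,1\}$ is replaced by $z_{ijk}\in[0,1]$. Dualizing the constraints that define $n_k$ in $(R)$ with multipliers $\boldsymbol\lambda=(\lambda_k)_{k\in\mathcal A}\in\mathbb R^{\mathcal A}$ gives the dual problem $\min_{\boldsymbol\lambda}\, g_n(\boldsymbol\lambda)+g_z(\boldsymbol\lambda)$, where $$g_n(\boldsymbol\lambda)=\max_{\mathbf n\ge 0}\ \sum_{k\in\mathcal A}n_k(\lambda_k-\log n_k),\qquad g_z(\boldsymbol\lambda)=\max_{\mathbf z}\ \sum_{k\in\mathcal A}\sum_{i\in\mathcal C_-'}\sum_{j\in\mathcal C_+'}(b_{ijk}-\lambda_kw_{ij})z_{ijk},$$ the second maximum being over all $\mathbf z$ with $z_{ijk}\in[0,1]$ that satisfy $\sum_{k}\sum_{j\in\mathcal C_+'}z_{ijk}=1$ for $i\in\mathcal C_-$ and $\sum_{k}\sum_{i\in\mathcal C_-'}z_{ijk}=1$ for $j\in\mathcal C_+$. Let $\boldsymbol\lambda^*$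 be an optimal solution of the dual problem, and let $\mathbf n^*(\boldsymbol\lambda^*)$ and $\mathbf z^*(\boldsymbol\lambda^*)$ be maximizers of the problems that define $g_n(\boldsymbol\lambda^*)$ and $g_z(\boldsymbol\lambda^*)$. If the maximizer $\mathbf z^*(\boldsymbol\lambda^*)$ is unique, then $(\mathbf z^*(\boldsymbol\lambda^*),\mathbf n^*(\boldsymbol\lambda^*))$ is an optimal solution of the binary problem $(P)$. It is also an optimal solution of the relaxation $(R)$, so $(P)$ and $(R)$ have the same optimal value. -/

import Mathlib

open scoped BigOperators

noncomputable section

namespace RelayAssignment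

/-- Arrays `z i j k`. The type `I` is the set of clients, `J` the set of relays and `K` the set of
access points. `Option I` is the set of clients together with a virtual client `u = none`, and
`Option J` is the set of relays together with a virtual relay `v = none`. -/
abbrev Assignment (I J K : Type*) := Option I → Option J → K → ℝ

/-- The load weight `w i j`: it is `2` for an actual client `i` and an actual relay `j`, and `1`
as soon as one of the two is virtual. -/
def w {I J : Type*} : Option I → Option J → ℝ
  | some _, some _ => 2
  | _, _ => 1

variable {I J K : Type*} [Fintype I] [Fintype J] [Fintype K]

/-- Every actual client and every actual relay is assigned exactly once. The virtual client and
the virtual relay are not constrained. -/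
def AssignmentConstraints (z : Assignment I J K) : Prop :=
  (∀ i : I, ∑ k : K, ∑ j : Option J, z (some i) j k = 1) ∧
    (∀ j : J, ∑ k : K, ∑ i : Option I, z i (some j) k = 1)

/-- The total load that `z` puts on the access point `k`. -/
def load (z : Assignment I J K) (k : K) : ℝ :=
  ∑ i : Option I, ∑ j : Option J, w i j * z i j k

/-- The nonlinear objective; the convention `0 * log 0 = 0` is that of `Real.log`. -/
def objective (b : Assignment I J K) (z : Assignment I J K) (n : K → ℝ) : ℝ :=
  ∑ k : K, ∑ i : Option I, ∑ j : Option J, b i j k * z i j k - ∑ k : K, n k * Real.log (n k)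

/-- Feasible points of the binary nonlinear assignment problem. -/
def binaryFeasible : Set (Assignment I J K × (K → ℝ)) :=
  {p | (∀ i j k, p.1 i j k = 0 ∨ p.1 i j k = 1) ∧ AssignmentConstraints p.1 ∧
    ∀ k, p.2 k = load p.1 k}

/-- Feasible points of the continuous relaxation. -/
def relaxedFeasible : Set (Assignment I J K × (K → ℝ)) :=
  {p | (∀ i j k, p.1 i j k ∈ Set.Icc (0 : ℝ) 1) ∧ AssignmentConstraints p.1 ∧
    ∀ k, p.2 k = load p.1 k}

/-- `p` lies in `S` and maximizes `f` over `S`. -/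
def IsMaximizer {α : Type*} (f : α → ℝ) (S : Set α) (p : α) : Prop :=
  p ∈ S ∧ ∀ q ∈ S, f q ≤ f p

/-- `p` is the only maximizer of `f` over `S`. -/
def IsUniqueMaximizer {α : Type*} (f : α → ℝ) (S : Set α) (p : α) : Prop :=
  IsMaximizer f S p ∧ ∀ q, IsMaximizer f S q → q = p

/-- `(z, n)` is an optimal solution of the binary problem. -/
def IsBinaryOptimal (b : Assignment I J K) (z : Assignment I J K) (n : K → ℝ) : Prop :=
  IsMaximizer (fun p : Assignment I J K × (K → ℝ) => objective b p.1 p.2) binaryFeasible (z, n)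

/-- `(z, n)` is an optimal solution of the continuous relaxation. -/
def IsRelaxedOptimal (b : Assignment I J K) (z : Assignment I J K) (n : K → ℝ) : Prop :=
  IsMaximizer (fun p : Assignment I J K × (K → ℝ) => objective b p.1 p.2) relaxedFeasible (z, n)

/-- Objective of the access point subproblem. -/
def apObjective (lam : K → ℝ) (n : K → ℝ) : ℝ :=
  ∑ k : K, n k * (lam k - Real.log (n k))

/-- Feasible set of the access point subproblem. -/
def apFeasible : Set (K → ℝ) := {n | ∀ k, 0 ≤ n k}

/-- Objective of the linear assignment subproblem. -/
def assignObjective (b : Assignment I J K) (lam : K → ℝ) (z : Assignment I J K) : ℝ :=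
  ∑ k : K, ∑ i : Option I, ∑ j : Option J, (b i j k - lam k * w i j) * z i j k

/-- Feasible set of the linear assignment subproblem. -/
def assignFeasible : Set (Assignment I J K) :=
  {z | (∀ i j k, z i j k ∈ Set.Icc (0 : ℝ) 1) ∧ AssignmentConstraints z}

/-- Optimal value of the access point subproblem. -/
def gn (lam : K → ℝ) : ℝ := sSup (apObjective lam '' apFeasible)

/-- Optimal value of the linear assignment subproblem. -/
def gz (b : Assignment I J K) (lam : K → ℝ) : ℝ :=
  sSup (assignObjective b lam '' assignFeasible)

/-- `lam` solves the Lagrangian dual problem: it minimizes `gn + gz` over all real vectors. -/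
def IsDualOptimal (b : Assignment I J K) (lam : K → ℝ) : Prop :=
  ∀ mu : K → ℝ, gn lam + gz b lam ≤ gn mu + gz b mu

/-- The supremum defining `gn` is over a set that is bounded above. -/
theorem apObjective_bddAbove (lam : K → ℝ) : BddAbove (apObjective lam '' apFeasible) := by
  refine ⟨∑ k : K, Real.exp (lam k - 1), ?_⟩
  rintro _ ⟨n, hn, rfl⟩
  refine Finset.sum_le_sum fun k _ => ?_
  rcases (hn k).eq_or_lt with h | h
  · rw [← h]; simp [Real.exp_nonneg]
  · have h1 := Real.add_one_le_exp (lam k - 1 - Real.log (n k))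
    have h2 : Real.exp (lam k - 1 - Real.log (n k)) * n k = Real.exp (lam k - 1) := by
      rw [Real.exp_sub, Real.exp_log h]; field_simp
    nlinarith

/-- The supremum defining `gz` is over a set that is bounded above. -/
theorem assignObjective_bddAbove (b : Assignment I J K) (lam : K → ℝ) :
    BddAbove (assignObjective b lam '' assignFeasible) := by
  refine ⟨∑ k : K, ∑ i : Option I, ∑ j : Option J, |b i j k - lam k * w i j|, ?_⟩
  rintro _ ⟨z, hz, rfl⟩
  refine Finset.sum_le_sum fun k _ => Finset.sum_le_sum fun i _ => Finset.sum_le_sum fun j _ => ?_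
  obtain ⟨h0, h1⟩ := hz.1 i j k
  nlinarith [le_abs_self (b i j k - lam k * w i j), abs_nonneg (b i j k - lam k * w i j)]

end RelayAssignment

end

/-!
The dual function is `gn + gz`, where `gn lam = ∑ k, exp (lam k - 1)` is smooth with gradient the
unique maximizer `n` (`gn_eq`, `eq_exp_of_isMaximizer`), and `gz` is a maximum of affine functions
of `lam` with slopes `-load y`, for `y` in a compact set. When the maximizer `z` at `lam` is unique,
maximizers at nearby multipliers converge to `z`, so that `gz` has gradient `-load z` at `lam`.
Stationarity of the dual at its minimum then reads `load z = n` (`load_eq_of_isDualOptimal`): the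
dualized constraint holds. The Lagrangian, which agrees with the objective on points that satisfy
this constraint, is maximized at `(z, n)`, so `(z, n)` solves the relaxation.

It remains to see that `z` is binary (`binary_of_isUniqueMaximizer`). View the fractional entries
of `z` as edges of a bipartite multigraph on the actual clients and relays, with loose ends at the
virtual ones. As the entries at an actual vertex sum to `1`, no vertex meets exactly one fractional
edge. Counting then shows that there are at least as many edges as vertices met, and in case of
equality there are no loose ends, so the vertex equations are linearly dependent. Either way some
nonzero `δ` on the fractional edges has sum zero at each vertex (`exists_ne_zero_sum_eq_zero`), and
`z ± ε δ` are feasible with mean `z`, against uniqueness.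
-/

open Filter Topology

namespace RelayAssignment

/-! ### Zero-sum weights on a bipartite multigraph with loose ends -/

/-- If a partial map has no fibre of size one, then twice the number of its values is at most
the number of points where it is defined. -/
theorem two_mul_card_values_le {E I : Type*} (a : E → Option I)
    (ha : ∀ e i, a e = some i → ∃ e', e' ≠ e ∧ a e' = some i)
    (U : Finset I) (hU : ∀ i, i ∈ U ↔ ∃ e, a e = some i)
    (S : Finset E) (hS : ∀ e, e ∈ S ↔ a e ≠ none) :
    2 * U.card ≤ S.card := by
  classical
  rw [← Finset.card_image_of_injective U (Option.some_injective I)]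
  refine Finset.mul_card_image_le_card_of_maps_to (f := a) (fun e he => ?_) 2 fun o ho => ?_
  · obtain ⟨i, hi⟩ := Option.ne_none_iff_exists'.1 ((hS e).1 he)
    exact Finset.mem_image.2 ⟨i, (hU i).2 ⟨e, hi⟩, hi.symm⟩
  · obtain ⟨i, hi, rfl⟩ := Finset.mem_image.1 ho
    obtain ⟨e, he⟩ := (hU i).1 hi
    obtain ⟨e', hne, he'⟩ := ha e i he
    exact Finset.one_lt_card.2 ⟨e, by simp [hS, he], e', by simp [hS, he'], hne.symm⟩

/-- An edge `e` joins `a e` and `c e`, where `none` stands for a loose end. If no vertex meets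
exactly one edge, then some nonzero weighting of the edges has sum zero at each vertex. -/
theorem exists_ne_zero_sum_eq_zero {E I J : Type*} [Fintype E] [Nonempty E]
    [Fintype I] [Fintype J] [DecidableEq I] [DecidableEq J] (a : E → Option I) (c : E → Option J)
    (ha : ∀ e i, a e = some i → ∃ e', e' ≠ e ∧ a e' = some i)
    (hc : ∀ e j, c e = some j → ∃ e', e' ≠ e ∧ c e' = some j) :
    ∃ δ : E → ℝ, δ ≠ 0 ∧ (∀ i, ∑ e, (if a e = some i then δ e else 0) = 0) ∧
      ∀ j, ∑ e, (if c e = some j then δ e else 0) = 0 := by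
  classical
  let U : Finset I := Finset.univ.filter fun i => ∃ e, a e = some i
  let W : Finset J := Finset.univ.filter fun j => ∃ e, c e = some j
  let S : Finset E := Finset.univ.filter fun e => a e ≠ none
  let T : Finset E := Finset.univ.filter fun e => c e ≠ none
  have hUS : 2 * U.card ≤ S.card :=
    two_mul_card_values_le a ha U (by simp [U]) S (by simp [S])
  have hWT : 2 * W.card ≤ T.card :=
    two_mul_card_values_le c hc W (by simp [W]) T (by simp [T])
  have hS : S.card ≤ Fintype.card E := Finset.card_le_univ S
  have hT : T.card ≤ Fintype.card E := Finset.card_le_univ T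
  let L : (E → ℝ) →ₗ[ℝ] (U ⊕ W → ℝ) := LinearMap.pi fun x =>
    Sum.elim (fun i : U => ∑ e, if a e = some i.1 then LinearMap.proj e else 0)
      (fun j : W => ∑ e, if c e = some j.1 then LinearMap.proj e else 0) x
  have hLl (δ : E → ℝ) (i : U) : L δ (Sum.inl i) = ∑ e, if a e = some i.1 then δ e else 0 := by
    simp only [L, LinearMap.pi_apply, Sum.elim_inl, LinearMap.sum_apply]
    refine Finset.sum_congr rfl fun e _ => ?_
    split_ifs <;> simp
  have hLr (δ : E → ℝ) (j : W) : L δ (Sum.inr j) = ∑ e, if c e = some j.1 then δ e else 0 := by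
    simp only [L, LinearMap.pi_apply, Sum.elim_inr, LinearMap.sum_apply]
    refine Finset.sum_congr rfl fun e _ => ?_
    split_ifs <;> simp
  suffices hker : LinearMap.ker L ≠ ⊥ by
    obtain ⟨δ, hδ, hne⟩ := Submodule.exists_mem_ne_zero_of_ne_bot hker
    rw [LinearMap.mem_ker] at hδ
    refine ⟨δ, hne, fun i => ?_, fun j => ?_⟩
    · by_cases hi : i ∈ U
      · rw [← hLl δ ⟨i, hi⟩, hδ]; rfl
      · refine Finset.sum_eq_zero fun e _ => if_neg fun h => hi ?_
        exact Finset.mem_filter.2 ⟨Finset.mem_univ _, e, h⟩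
    · by_cases hj : j ∈ W
      · rw [← hLr δ ⟨j, hj⟩, hδ]; rfl
      · refine Finset.sum_eq_zero fun e _ => if_neg fun h => hj ?_
        exact Finset.mem_filter.2 ⟨Finset.mem_univ _, e, h⟩
  rcases lt_or_ge (U.card + W.card) (Fintype.card E) with hlt | hge
  · apply LinearMap.ker_ne_bot_of_finrank_lt
    simpa using hlt
  · -- Now `2 * |U| = 2 * |W| = |E|`: there are no loose ends, so the equations at `U` and those
    -- at `W` have the same sum and cannot be independent.
    intro hbot
    have hSu : S = Finset.univ := Finset.eq_univ_of_card S (by omega)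
    have hTu : T = Finset.univ := Finset.eq_univ_of_card T (by omega)
    have hsum (δ : E → ℝ) : ∑ i, L δ (Sum.inl i) = ∑ j, L δ (Sum.inr j) := by
      have h1 : ∑ i, L δ (Sum.inl i) = ∑ e, δ e := by
        simp only [hLl]
        rw [Finset.sum_comm]
        refine Finset.sum_congr rfl fun e _ => ?_
        have he : e ∈ S := hSu ▸ Finset.mem_univ e
        obtain ⟨i, hi⟩ := Option.ne_none_iff_exists'.1 (Finset.mem_filter.1 he).2
        have hiU : i ∈ U := Finset.mem_filter.2 ⟨Finset.mem_univ _, e, hi⟩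
        rw [Finset.sum_eq_single (⟨i, hiU⟩ : U)]
        · simp [hi]
        · intro x _ hx
          refine if_neg fun h => hx (Subtype.ext ?_)
          rw [hi] at h
          exact (Option.some_injective _ h).symm
        · simp
      have h2 : ∑ j, L δ (Sum.inr j) = ∑ e, δ e := by
        simp only [hLr]
        rw [Finset.sum_comm]
        refine Finset.sum_congr rfl fun e _ => ?_
        have he : e ∈ T := hTu ▸ Finset.mem_univ e
        obtain ⟨j, hj⟩ := Option.ne_none_iff_exists'.1 (Finset.mem_filter.1 he).2
        have hjW : j ∈ W := Finset.mem_filter.2 ⟨Finset.mem_univ _, e, hj⟩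
        rw [Finset.sum_eq_single (⟨j, hjW⟩ : W)]
        · simp [hj]
        · intro x _ hx
          refine if_neg fun h => hx (Subtype.ext ?_)
          rw [hj] at h
          exact (Option.some_injective _ h).symm
        · simp
      rw [h1, h2]
    have hfin : Module.finrank ℝ (E → ℝ) = Module.finrank ℝ (U ⊕ W → ℝ) := by
      simp only [Module.finrank_fintype_fun_eq_card, Fintype.card_sum, Fintype.card_coe]
      omega
    have hsurj : Function.Surjective L :=
      (LinearMap.injective_iff_surjective_of_finrank_eq_finrank hfin).1 (LinearMap.ker_eq_bot.1 hbot)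
    obtain ⟨e0⟩ := ‹Nonempty E›
    have he0 : e0 ∈ S := hSu ▸ Finset.mem_univ e0
    obtain ⟨i, hi⟩ := Option.ne_none_iff_exists'.1 (Finset.mem_filter.1 he0).2
    have hiU : i ∈ U := Finset.mem_filter.2 ⟨Finset.mem_univ _, e0, hi⟩
    -- Surjectivity reaches a vector that violates the dependency `hsum` of the equations.
    obtain ⟨δ, hδ⟩ := hsurj (Pi.single (Sum.inl ⟨i, hiU⟩) 1)
    have := hsum δ
    simp [hδ, Pi.single_apply] at this

/-! ### Integrality of a unique maximizer -/

/-- A finite sum equal to `1` cannot have exactly one term that is neither `0` nor `1`. -/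
theorem exists_ne_fractional {E : Type*} (s : Finset E) (f : E → ℝ) (hs : ∑ e ∈ s, f e = 1)
    (e : E) (he : e ∈ s) (h0 : f e ≠ 0) (h1 : f e ≠ 1) (hb : f e ∈ Set.Icc (0 : ℝ) 1) :
    ∃ e' ∈ s, e' ≠ e ∧ ¬ (f e' = 0 ∨ f e' = 1) := by
  classical
  by_contra! hcon
  have hint : ∃ m : ℤ, ∑ x ∈ s.erase e, f x = m := by
    refine ⟨∑ x ∈ s.erase e, if f x = 0 then 0 else 1, ?_⟩
    push_cast
    refine Finset.sum_congr rfl fun x hx => ?_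
    have hx' := Finset.mem_erase.1 hx
    rcases hcon x hx'.2 hx'.1 with h | h <;> simp [h]
  obtain ⟨m, hm⟩ := hint
  rw [← Finset.add_sum_erase s f he, hm] at hs
  have hlt0 : 0 < f e := lt_of_le_of_ne hb.1 (Ne.symm h0)
  have hlt1 : f e < 1 := lt_of_le_of_ne hb.2 h1
  have hm0 : (0 : ℝ) < m := by linarith
  have hm1 : (m : ℝ) < 1 := by linarith
  norm_cast at hm0 hm1
  omega

variable {I J K : Type*} [Fintype I] [Fintype J] [Fintype K]

theorem assignObjective_add_smul (b : Assignment I J K) (lam : K → ℝ) (z d : Assignment I J K)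
    (t : ℝ) :
    assignObjective b lam (z + t • d) = assignObjective b lam z + t * assignObjective b lam d := by
  simp only [assignObjective, Finset.mul_sum, ← Finset.sum_add_distrib, Pi.add_apply,
    Pi.smul_apply, smul_eq_mul]
  refine Finset.sum_congr rfl fun k _ => Finset.sum_congr rfl fun i _ =>
    Finset.sum_congr rfl fun j _ => ?_
  ring

/-- A unique maximizer of the linear objective is not the midpoint of a nontrivial feasible
segment, since the objective would be constant on that segment. -/
theorem not_feasible_segment {b : Assignment I J K} {lam : K → ℝ} {z d : Assignment I J K}
    (hz : IsUniqueMaximizer (assignObjective b lam) assignFeasible z) (hd : d ≠ 0) {t : ℝ}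
    (ht : 0 < t) (hp : z + t • d ∈ assignFeasible) (hm : z + (-t) • d ∈ assignFeasible) :
    False := by
  have h1 := hz.1.2 _ hp
  have h2 := hz.1.2 _ hm
  rw [assignObjective_add_smul] at h1 h2
  have heq : z + t • d = z := by
    refine hz.2 _ ⟨hp, fun q hq => ?_⟩
    rw [assignObjective_add_smul]
    linarith [hz.1.2 q hq]
  have : t • d = 0 := by simpa using heq
  exact (smul_ne_zero ht.ne' hd) this

/-- A unique maximizer is a vertex of the assignment polytope, and the vertices are binary. -/
theorem binary_of_isUniqueMaximizer {b : Assignment I J K} {lam : K → ℝ} {z : Assignment I J K}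
    (hz : IsUniqueMaximizer (assignObjective b lam) assignFeasible z) (i : Option I)
    (j : Option J) (k : K) : z i j k = 0 ∨ z i j k = 1 := by
  classical
  by_contra hijk
  obtain ⟨hbox, hI, hJ⟩ := hz.1.1
  -- The edges of the multigraph are the positions of the fractional entries of `z`.
  let E := {e : Option I × Option J × K // ¬ (z e.1 e.2.1 e.2.2 = 0 ∨ z e.1 e.2.1 e.2.2 = 1)}
  have : Nonempty E := ⟨⟨(i, j, k), hijk⟩⟩
  have hsumI (x : Assignment I J K) (i : I) : ∑ k : K, ∑ j : Option J, x (some i) j k =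
      ∑ e ∈ Finset.univ.filter (fun e : Option I × Option J × K => e.1 = some i),
        x e.1 e.2.1 e.2.2 := by
    rw [Finset.sum_filter, Fintype.sum_prod_type, Finset.sum_eq_single (some i)]
    · simp only [if_true]
      rw [Fintype.sum_prod_type, Finset.sum_comm]
    · intro x _ hx
      simp [hx]
    · simp
  have hsumJ (x : Assignment I J K) (j : J) : ∑ k : K, ∑ i : Option I, x i (some j) k =
      ∑ e ∈ Finset.univ.filter (fun e : Option I × Option J × K => e.2.1 = some j),
        x e.1 e.2.1 e.2.2 := by
    rw [Finset.sum_filter, Fintype.sum_prod_type, Finset.sum_comm]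
    refine Finset.sum_congr rfl fun i _ => ?_
    rw [Fintype.sum_prod_type, Finset.sum_eq_single (some j)]
    · simp
    · intro x _ hx
      simp [hx]
    · simp
  obtain ⟨δ, hδ, hδI, hδJ⟩ := exists_ne_zero_sum_eq_zero (E := E) (fun e => e.1.1)
    (fun e => e.1.2.1)
    (by
      rintro ⟨e, he⟩ i hi
      obtain ⟨e', h1, h2, h3⟩ := exists_ne_fractional _ _ ((hsumI z i).symm.trans (hI i)) e
        (by simpa using hi) (fun h => he (Or.inl h)) (fun h => he (Or.inr h)) (hbox _ _ _)
      exact ⟨⟨e', h3⟩, fun h => h2 (congrArg Subtype.val h), (Finset.mem_filter.1 h1).2⟩)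
    (by
      rintro ⟨e, he⟩ j hj
      obtain ⟨e', h1, h2, h3⟩ := exists_ne_fractional _ _ ((hsumJ z j).symm.trans (hJ j)) e
        (by simpa using hj) (fun h => he (Or.inl h)) (fun h => he (Or.inr h)) (hbox _ _ _)
      exact ⟨⟨e', h3⟩, fun h => h2 (congrArg Subtype.val h), (Finset.mem_filter.1 h1).2⟩)
  let d : Assignment I J K := fun i j k =>
    if h : ¬ (z i j k = 0 ∨ z i j k = 1) then δ ⟨(i, j, k), h⟩ else 0
  have hdE (e : E) : d e.1.1 e.1.2.1 e.1.2.2 = δ e := dif_pos e.2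
  have hd0 {i j k} (h : z i j k = 0 ∨ z i j k = 1) : d i j k = 0 := dif_neg (not_not.2 h)
  have hsub (p : Option I × Option J × K → Prop) [DecidablePred p] :
      ∑ e ∈ Finset.univ.filter p, d e.1 e.2.1 e.2.2 = ∑ e : E, if p e.1 then δ e else 0 := by
    rw [Finset.sum_filter]
    simp only [← hdE]
    rw [← Finset.sum_subtype (Finset.univ.filter fun e : Option I × Option J × K =>
      ¬ (z e.1 e.2.1 e.2.2 = 0 ∨ z e.1 e.2.1 e.2.2 = 1)) (by simp)
      (fun e => if p e then d e.1 e.2.1 e.2.2 else 0)]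
    rw [Finset.sum_filter]
    refine Finset.sum_congr rfl fun e _ => ?_
    by_cases h : z e.1 e.2.1 e.2.2 = 0 ∨ z e.1 e.2.1 e.2.2 = 1
    · rw [if_neg (not_not.2 h), hd0 h, ite_self]
    · rw [if_pos h]
  have hdne : d ≠ 0 := by
    intro h
    refine hδ (funext fun e => ?_)
    rw [← hdE, h]; rfl
  have hev : ∀ᶠ t in 𝓝[>] (0 : ℝ), ∀ i j k, ¬ (z i j k = 0 ∨ z i j k = 1) →
      t * |d i j k| < z i j k ∧ t * |d i j k| < 1 - z i j k := by
    refine Eventually.filter_mono nhdsWithin_le_nhds ?_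
    simp only [eventually_all]
    intro i j k h
    have hc : Tendsto (fun t : ℝ => t * |d i j k|) (𝓝 0) (𝓝 0) := by
      have : Continuous fun t : ℝ => t * |d i j k| := by fun_prop
      simpa using this.tendsto 0
    rw [not_or] at h
    have h0 : 0 < z i j k := lt_of_le_of_ne (hbox i j k).1 (Ne.symm h.1)
    have h1 : z i j k < 1 := lt_of_le_of_ne (hbox i j k).2 h.2
    exact (hc.eventually_lt_const h0).and (hc.eventually_lt_const (by linarith))
  obtain ⟨t, ht, ht0⟩ := (hev.and self_mem_nhdsWithin).exists
  have hfeas (s : ℝ) (hs : |s| = t) : z + s • d ∈ assignFeasible := by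
    refine ⟨fun i j k => ?_, fun i => ?_, fun j => ?_⟩
    · simp only [Pi.add_apply, Pi.smul_apply, smul_eq_mul]
      by_cases h : z i j k = 0 ∨ z i j k = 1
      · rw [hd0 h, mul_zero, add_zero]
        exact hbox i j k
      · have h1 := ht i j k h
        rw [← hs, ← abs_mul] at h1
        constructor <;> linarith [neg_abs_le (s * d i j k), le_abs_self (s * d i j k)]
    · simp only [Pi.add_apply, Pi.smul_apply, smul_eq_mul, Finset.sum_add_distrib,
        ← Finset.mul_sum, hI i, hsumI d i]
      rw [hsub, hδI i, mul_zero, add_zero]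
    · simp only [Pi.add_apply, Pi.smul_apply, smul_eq_mul, Finset.sum_add_distrib,
        ← Finset.mul_sum, hJ j, hsumJ d j]
      rw [hsub, hδJ j, mul_zero, add_zero]
  have ht0' : 0 < t := ht0
  exact not_feasible_segment hz hdne ht0' (hfeas t (abs_of_pos ht0'))
    (hfeas (-t) (by rw [abs_neg, abs_of_pos ht0']))

/-! ### The access point subproblem -/

/-- With the convention `0 * log 0 = 0`, the concave function `x * (l - log x)` on `x ≥ 0` is at
most `exp (l - 1)`. -/
theorem mul_sub_log_le (l : ℝ) {x : ℝ} (hx : 0 ≤ x) :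
    x * (l - Real.log x) ≤ Real.exp (l - 1) := by
  rcases hx.eq_or_lt with h | h
  · rw [← h]; simp [Real.exp_nonneg]
  · have h1 := Real.add_one_le_exp (l - 1 - Real.log x)
    have h2 : Real.exp (l - 1 - Real.log x) * x = Real.exp (l - 1) := by
      rw [Real.exp_sub, Real.exp_log h]; field_simp
    nlinarith

/-- The maximum of `x * (l - log x)` is attained only at `exp (l - 1)`. -/
theorem eq_exp_of_mul_sub_log_eq (l : ℝ) {x : ℝ} (hx : 0 ≤ x)
    (h : x * (l - Real.log x) = Real.exp (l - 1)) : x = Real.exp (l - 1) := by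
  rcases hx.eq_or_lt with h0 | h0
  · rw [← h0, zero_mul] at h
    exact absurd h (Real.exp_pos _).ne
  · by_contra hne
    have hne' : l - 1 - Real.log x ≠ 0 := by
      intro h'
      apply hne
      rw [sub_eq_zero.1 h', Real.exp_log h0]
    have h1 := Real.add_one_lt_exp hne'
    have h2 : Real.exp (l - 1 - Real.log x) * x = Real.exp (l - 1) := by
      rw [Real.exp_sub, Real.exp_log h0]; field_simp
    nlinarith

theorem apObjective_le (lam : K → ℝ) {n : K → ℝ} (hn : n ∈ apFeasible) :
    apObjective lam n ≤ ∑ k, Real.exp (lam k - 1) :=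
  Finset.sum_le_sum fun k _ => mul_sub_log_le (lam k) (hn k)

theorem apObjective_exp (lam : K → ℝ) :
    apObjective lam (fun k => Real.exp (lam k - 1)) = ∑ k, Real.exp (lam k - 1) := by
  simp [apObjective]

omit [Fintype K] in
theorem exp_mem_apFeasible (lam : K → ℝ) : (fun k => Real.exp (lam k - 1)) ∈ apFeasible :=
  fun _ => (Real.exp_pos _).le

theorem gn_eq (lam : K → ℝ) : gn lam = ∑ k, Real.exp (lam k - 1) := by
  refine IsGreatest.csSup_eq ⟨⟨_, exp_mem_apFeasible lam, apObjective_exp lam⟩, ?_⟩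
  rintro _ ⟨n, hn, rfl⟩
  exact apObjective_le lam hn

theorem eq_exp_of_isMaximizer {lam n : K → ℝ} (hn : IsMaximizer (apObjective lam) apFeasible n)
    (k : K) : n k = Real.exp (lam k - 1) := by
  have h1 : apObjective lam n = ∑ k, Real.exp (lam k - 1) :=
    le_antisymm (apObjective_le lam hn.1)
      ((apObjective_exp lam).symm.le.trans (hn.2 _ (exp_mem_apFeasible lam)))
  have h2 := (Finset.sum_eq_sum_iff_of_le fun k _ => mul_sub_log_le (lam k) (hn.1 k)).1 h1 k
    (Finset.mem_univ k)
  exact eq_exp_of_mul_sub_log_eq _ (hn.1 k) h2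

/-- The right derivative of `gn` at `lam` in the direction `d`. -/
theorem tendsto_gn_slope (lam d : K → ℝ) :
    Tendsto (fun t : ℝ => (gn (lam + t • d) - gn lam) / t) (𝓝[>] 0)
      (𝓝 (∑ k, d k * Real.exp (lam k - 1))) := by
  have h : HasDerivAt (fun t : ℝ => gn (lam + t • d)) (∑ k, d k * Real.exp (lam k - 1)) 0 := by
    simp only [gn_eq, Pi.add_apply, Pi.smul_apply, smul_eq_mul]
    refine HasDerivAt.fun_sum fun k _ => ?_
    have h1 : HasDerivAt (fun t : ℝ => lam k + t * d k - 1) (d k) 0 := by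
      simpa using (((hasDerivAt_id (0 : ℝ)).mul_const (d k)).const_add (lam k)).sub_const 1
    simpa [mul_comm] using h1.exp
  have h2 := (hasDerivAt_iff_tendsto_slope.1 h).mono_left
    (nhdsWithin_mono (0 : ℝ) (fun t (ht : 0 < t) => ht.ne' : Set.Ioi (0 : ℝ) ⊆ {0}ᶜ))
  refine h2.congr fun t => ?_
  simp [slope_def_field]

/-! ### The assignment subproblem and dual stationarity -/

theorem isCompact_assignFeasible : IsCompact (assignFeasible : Set (Assignment I J K)) := by
  refine (isCompact_Icc (a := (0 : Assignment I J K)) (b := 1)).of_isClosed_subset ?_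
    fun z hz => ⟨fun i j k => (hz.1 i j k).1, fun i j k => (hz.1 i j k).2⟩
  simp only [assignFeasible, AssignmentConstraints, Set.mem_Icc, Set.ofPred_and, Set.ofPred_forall]
  refine IsClosed.inter ?_ (IsClosed.inter ?_ ?_)
  · exact isClosed_iInter fun i => isClosed_iInter fun j => isClosed_iInter fun k =>
      (isClosed_le (by fun_prop) (by fun_prop)).inter (isClosed_le (by fun_prop) (by fun_prop))
  · exact isClosed_iInter fun i => isClosed_eq (by fun_prop) (by fun_prop)
  · exact isClosed_iInter fun i => isClosed_eq (by fun_prop) (by fun_prop)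

theorem continuous_assignObjective (b : Assignment I J K) :
    Continuous fun p : (K → ℝ) × Assignment I J K => assignObjective b p.1 p.2 := by
  unfold assignObjective
  fun_prop

omit [Fintype K] in
theorem continuous_load (k : K) : Continuous fun z : Assignment I J K => load z k := by
  unfold load
  fun_prop

theorem gz_eq_of_isMaximizer {b : Assignment I J K} {lam : K → ℝ} {z : Assignment I J K}
    (hz : IsMaximizer (assignObjective b lam) assignFeasible z) :
    gz b lam = assignObjective b lam z := by
  refine IsGreatest.csSup_eq ⟨⟨z, hz.1, rfl⟩, ?_⟩
  rintro _ ⟨y, hy, rfl⟩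
  exact hz.2 y hy

theorem assignObjective_eq (b : Assignment I J K) (lam : K → ℝ) (z : Assignment I J K) :
    assignObjective b lam z =
      ∑ k : K, ∑ i : Option I, ∑ j : Option J, b i j k * z i j k - ∑ k, lam k * load z k := by
  simp only [assignObjective, load, Finset.mul_sum, ← Finset.sum_sub_distrib]
  refine Finset.sum_congr rfl fun k _ => Finset.sum_congr rfl fun i _ =>
    Finset.sum_congr rfl fun j _ => ?_
  ring

theorem assignObjective_shift (b : Assignment I J K) (lam d : K → ℝ) (t : ℝ)
    (z : Assignment I J K) :
    assignObjective b (lam + t • d) z =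
      assignObjective b lam z - t * ∑ k, d k * load z k := by
  simp only [assignObjective_eq, Pi.add_apply, Pi.smul_apply, smul_eq_mul, add_mul,
    Finset.sum_add_distrib, Finset.mul_sum, mul_assoc]
  ring

/-- One-sided stationarity of the dual in the direction `d`: the derivative of `gn` dominates
that of `-gz`. -/
theorem sum_mul_load_le {b : Assignment I J K} {lam : K → ℝ} (hlam : IsDualOptimal b lam)
    {z : Assignment I J K} (hz : IsUniqueMaximizer (assignObjective b lam) assignFeasible z)
    (d : K → ℝ) : ∑ k, d k * load z k ≤ ∑ k, d k * Real.exp (lam k - 1) := by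
  have hex (t : ℝ) : ∃ y, IsMaximizer (assignObjective b (lam + t • d)) assignFeasible y := by
    obtain ⟨y, hy, hmax⟩ := isCompact_assignFeasible.exists_isMaxOn ⟨z, hz.1.1⟩
      ((continuous_assignObjective b).comp (Continuous.prodMk_right (lam + t • d))).continuousOn
    exact ⟨y, hy, fun q hq => hmax hq⟩
  choose y hy using hex
  -- Along an ultrafilter of positive `t` tending to `0`, the maximizers `y t` converge.
  let 𝒰 : Ultrafilter ℝ := Ultrafilter.of (𝓝[>] (0 : ℝ))
  have h𝒰 : (𝒰 : Filter ℝ) ≤ 𝓝[>] (0 : ℝ) := Ultrafilter.of_le _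
  obtain ⟨y₀, hy₀, hlim⟩ := isCompact_assignFeasible.ultrafilter_le_nhds (𝒰.map y)
    (le_principal_iff.2 (Filter.mem_map.2 (univ_mem' fun t => (hy t).1)))
  have hlim : Tendsto y 𝒰 (𝓝 y₀) := hlim
  have hmu : Tendsto (fun t : ℝ => lam + t • d) 𝒰 (𝓝 lam) := by
    have hc : Continuous fun t : ℝ => lam + t • d := by fun_prop
    have := hc.tendsto 0
    rw [zero_smul, add_zero] at this
    exact this.mono_left (h𝒰.trans nhdsWithin_le_nhds)
  have hy₀z : y₀ = z := by
    refine hz.2 _ ⟨hy₀, fun q hq => ?_⟩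
    have h1 := ((continuous_assignObjective b).tendsto (lam, y₀)).comp (hmu.prodMk_nhds hlim)
    have h2 := ((continuous_assignObjective b).tendsto (lam, q)).comp
      (hmu.prodMk_nhds (tendsto_const_nhds (x := q)))
    exact le_of_tendsto_of_tendsto' h2 h1 fun t => (hy t).2 q hq
  subst hy₀z
  have hcont : Continuous fun x : Assignment I J K => ∑ k, d k * load x k :=
    continuous_finsetSum _ fun k _ => continuous_const.mul (continuous_load k)
  refine le_of_tendsto_of_tendsto ((hcont.tendsto y₀).comp hlim)
    ((tendsto_gn_slope lam d).mono_left h𝒰) (h𝒰 ?_)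
  filter_upwards [self_mem_nhdsWithin] with t (ht : 0 < t)
  have h1 := hlam (lam + t • d)
  rw [gz_eq_of_isMaximizer (hy t), gz_eq_of_isMaximizer hz.1, assignObjective_shift] at h1
  have h2 := hz.1.2 (y t) (hy t).1
  simp only [Function.comp_apply]
  rw [le_div_iff₀ ht]
  linarith

/-- Dual stationarity: a unique maximizer at a dual optimum satisfies the dualized constraint. -/
theorem load_eq_of_isDualOptimal {b : Assignment I J K} {lam : K → ℝ}
    (hlam : IsDualOptimal b lam) {z : Assignment I J K}
    (hz : IsUniqueMaximizer (assignObjective b lam) assignFeasible z) (k : K) :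
    load z k = Real.exp (lam k - 1) := by
  -- Moving along the residual `load z - n` bounds the sum of its squares by zero.
  have h := sum_mul_load_le hlam hz fun k => load z k - Real.exp (lam k - 1)
  have h1 : ∑ k, (load z k - Real.exp (lam k - 1)) ^ 2 ≤ 0 := by
    rw [← sub_nonpos, ← Finset.sum_sub_distrib] at h
    refine le_of_eq_of_le (Finset.sum_congr rfl fun k _ => ?_) h
    ring
  have h2 := (Finset.sum_eq_zero_iff_of_nonneg fun k _ =>
    sq_nonneg (load z k - Real.exp (lam k - 1))).1
      (le_antisymm h1 (Finset.sum_nonneg fun k _ => sq_nonneg _)) k (Finset.mem_univ k)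
  exact sub_eq_zero.1 (pow_eq_zero_iff two_ne_zero |>.1 h2)

/-! ### Optimality -/

/-- On points that satisfy the dualized constraint, the objective is the Lagrangian. -/
theorem objective_load (b : Assignment I J K) (lam : K → ℝ) (z : Assignment I J K) {n : K → ℝ}
    (hn : ∀ k, n k = load z k) :
    objective b z n = assignObjective b lam z + apObjective lam n := by
  rw [assignObjective_eq, objective, apObjective]
  simp only [mul_sub, Finset.sum_sub_distrib, hn]
  simp only [mul_comm (lam _)]
  ring

omit [Fintype K] in
theorem load_nonneg {z : Assignment I J K} (hz : ∀ i j k, 0 ≤ z i j k) (k : K) : 0 ≤ load z k := by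
  refine Finset.sum_nonneg fun i _ => Finset.sum_nonneg fun j _ => mul_nonneg ?_ (hz i j k)
  rcases i with _ | i <;> rcases j with _ | j <;> simp [w]

theorem binaryFeasible_subset_relaxedFeasible :
    (binaryFeasible : Set (Assignment I J K × (K → ℝ))) ⊆ relaxedFeasible := by
  rintro p ⟨h1, h2, h3⟩
  refine ⟨fun i j k => ?_, h2, h3⟩
  rcases h1 i j k with h | h <;> simp [h]

end RelayAssignment

theorem mainTheorem3 {I J K : Type*} [Fintype I] [Fintype J] [Fintype K]
    (b : RelayAssignment.Assignment I J K)
    (lam : K → ℝ) (hlam : RelayAssignment.IsDualOptimal b lam)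
    (n : K → ℝ)
    (hn : RelayAssignment.IsMaximizer (RelayAssignment.apObjective lam)
      RelayAssignment.apFeasible n)
    (z : RelayAssignment.Assignment I J K)
    (hz : RelayAssignment.IsUniqueMaximizer (RelayAssignment.assignObjective b lam)
      RelayAssignment.assignFeasible z) :
    RelayAssignment.IsBinaryOptimal b z n ∧ RelayAssignment.IsRelaxedOptimal b z n := by
  open RelayAssignment in
  have hload (k : K) : n k = load z k :=
    (eq_exp_of_isMaximizer hn k).trans (load_eq_of_isDualOptimal hlam hz k).symm
  have hopt : IsRelaxedOptimal b z n := by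
    refine ⟨⟨hz.1.1.1, hz.1.1.2, hload⟩, ?_⟩
    rintro ⟨y, m⟩ ⟨hy, hyc, hm⟩
    have h1 := hz.1.2 y ⟨hy, hyc⟩
    have h2 := hn.2 m fun k => (load_nonneg (fun i j k => (hy i j k).1) k).trans_eq (hm k).symm
    change objective b y m ≤ objective b z n
    rw [objective_load b lam y hm, objective_load b lam z hload]
    exact add_le_add h1 h2
  exact ⟨⟨⟨binary_of_isUniqueMaximizer hz, hz.1.1.2, hload⟩,
    fun q hq => hopt.2 q (binaryFeasible_subset_relaxedFeasible hq)⟩, hopt⟩
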